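/- Let $n\ge 2$ and let $\overrightarrow{C_n}$ be the directed cycle, with vertices $v_1,\dots,v_n$ and edge set $E=\{(v_i,v_{i+1}) : 1\le i<n\}\cup\{(v_n,v_1)\}$ (so $|E|=n$). A proper coloring is a map $\kappa:\{v_1,\dots,v_n\}\to\{1,2,3,\dots\}$ with $\kappa(u)\ne\kappa(v)$ for every $(u,v)\in E$; let $\mathrm{asc}(\kappa)$ be the number of edges $(u,v)\in E$ with $\kappa(u)<\kappa(v)$, and let $$X_{\overrightarrow{C_n}}(\mathbf x,t)=\sum_{\kappa\text{ proper}} t^{\mathrm{asc}(\kappa)}\,x_{\kappa(v_1)}x_{\kappa(v_2)}\cdots x_{\kappa(v_n)}$$ be the chromatic quasisymmetric function of $\overrightarrow{C_n}$, a formal power series in $\mathbf x=(x_1,x_2,\dots)$ with coefficients in $\mathbb Q[t]$. Let $e_k=e_k(\mathbf x)$ be the elementary symmetric functions, $e_\lambda=\prod_i e_{\lambda_i}$ for a partition $\lambda$, and $[k]_t=1+t+\cdots+t^{k-1}$ (so $[0]_t=0$). Then $$X_{\overrightarrow{C_n}}(\mathbf x,t)=\sum_{\lambda\vdash n}e_\lambda(\mathbf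 x)\sum_{\mu:\,\lambda(\mu)=\lambda}\mu_1\; t[\mu_1-1]_t\; t[\mu_2-1]_t\cdots t[\mu_{l(\lambda)}-1]_t ,$$ where $\mu=(\mu_1,\mu_2,\dots,\mu_{l(\lambda)})$ runs over the compositions of $n$ whose parts, written in decreasing order, form $\lambda$, and $l(\lambda)$ is the number of parts of $\lambda$. Consequently $X_{\overrightarrow{C_n}}(\mathbf x,t)$ is a palindromic, $e$-positive and $e$-unimodal polynomial in $t$. That is, $X_{\overrightarrow{C_n}}(\mathbf x,t)=\sum_{j=0}^{n}a_j(\mathbf x)t^j$, where $a_j=a_{n-j}$ for $0\le j\le n$, every $a_j$ is $e$-positive, and $a_{j+1}-a_j$ is $e$-positive for every integer $j$ with $0\le j\le\frac{n-1}{2}$. Here a symmetric function that is homogeneous of degree $n$ is called $e$-positive if its expansion in the basis $\{e_\lambda:\lambda\vdash n\}$ has nonnegative coefficients. -/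

import Mathlib

namespace ChromaticQSym

/-- The directed cycle on the vertices `v₁, …, vₙ` (here `0, …, n - 1`): its edges are
`(vᵢ, vᵢ₊₁)` for `1 ≤ i < n`, together with `(vₙ, v₁)`. It is loopless for `n ≥ 2`. -/
def directedCycle (n : ℕ) : Digraph (Fin n) where
  Adj i j := (i : ℕ) + 1 = (j : ℕ) ∨ ((i : ℕ) + 1 = n ∧ (j : ℕ) = 0)

section Digraph

variable {V : Type*} (G : Digraph V)

/-- The number of directed edges. -/
noncomputable def numEdges : ℕ := Set.ncard {p : V × V | G.Adj p.1 p.2}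

/-- A proper coloring of a (loopless) digraph by positive integers: a proper coloring of the
underlying undirected graph. -/
def IsProper (κ : V → ℕ+) : Prop := ∀ u v, G.Adj u v → κ u ≠ κ v

/-- The number of ascents of a coloring: directed edges `(u, v)` with `κ u < κ v`. -/
noncomputable def asc (κ : V → ℕ+) : ℕ :=
  Set.ncard {p : V × V | G.Adj p.1 p.2 ∧ κ p.1 < κ p.2}

/-- The exponent vector of the monomial `x_κ = ∏ v, x_{κ v}`. -/
noncomputable def content [Fintype V] (κ : V → ℕ+) : ℕ+ →₀ ℕ := ∑ v, Finsupp.single (κ v) 1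

/-- Only finitely many proper colorings `κ` have a given monomial `x_κ`. -/
theorem finite_properColorings [Fintype V] (d : ℕ+ →₀ ℕ) :
    {κ : V → ℕ+ | IsProper G κ ∧ content κ = d}.Finite := by
  classical
  refine (Set.Finite.pi' (fun _ : V => d.support.finite_toSet)).subset ?_
  rintro κ ⟨-, rfl⟩ v
  simp only [Finset.mem_coe, Finsupp.mem_support_iff, content, Finsupp.finsetSum_apply]
  intro h
  have := Finset.sum_eq_zero_iff.mp h v (Finset.mem_univ v)
  simp at this

/-- The chromatic quasisymmetric function `X_G(x, t) = ∑_κ t ^ asc κ * x_κ`, the sum being over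
all proper colorings `κ : V → ℕ+`. It is a formal power series in `x₁, x₂, …` with coefficients
in `ℚ[t]`: the coefficient of the monomial `x ^ d` is the sum of `t ^ asc κ` over the finitely
many proper colorings `κ` with `x_κ = x ^ d`. -/
noncomputable def chromaticQSym [Fintype V] : MvPowerSeries ℕ+ (Polynomial ℚ) :=
  fun d => ∑ κ ∈ (finite_properColorings G d).toFinset, (Polynomial.X : Polynomial ℚ) ^ asc G κ

end Digraph

section Symmetric

open Classical in
/-- The elementary symmetric function `e_k` in the variables `x₁, x₂, …`: the sum of all
squarefree monomials of degree `k`. -/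
noncomputable def esymm (R : Type*) [CommSemiring R] (k : ℕ) : MvPowerSeries ℕ+ R :=
  fun d => if d.degree = k ∧ ∀ i, d i ≤ 1 then 1 else 0

/-- `e_p = ∏ e_{p_i}` for an integer partition `p` with parts `p_i`. -/
noncomputable def esymmPart (R : Type*) [CommSemiring R] {n : ℕ} (p : n.Partition) :
    MvPowerSeries ℕ+ R :=
  (p.parts.map (esymm R)).prod

/-- A power series `f` (over `ℚ`) is an `e`-positive symmetric function of degree `n`: it is a
linear combination of the `e_p`, for `p` a partition of `n`, with nonnegative coefficients. -/
def IsEPositive (n : ℕ) (f : MvPowerSeries ℕ+ ℚ) : Prop :=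
  ∃ c : n.Partition → ℚ, (∀ p, 0 ≤ c p) ∧ f = ∑ p, c p • esymmPart ℚ p

end Symmetric

section InT

/-- The coefficient `a_j(x)` of `t ^ j` in a power series `F(x, t)` with coefficients in
`ℚ[t]`. -/
noncomputable def tCoeff (F : MvPowerSeries ℕ+ (Polynomial ℚ)) (j : ℕ) : MvPowerSeries ℕ+ ℚ :=
  fun d => (MvPowerSeries.coeff d F).coeff j

/-- `F(x, t) = ∑_{j = 0}^{m} a_j(x) t ^ j` with `a_j = a_{m - j}` for all `0 ≤ j ≤ m`. -/
def IsPalindromic (m : ℕ) (F : MvPowerSeries ℕ+ (Polynomial ℚ)) : Prop :=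
  (∀ j, m < j → tCoeff F j = 0) ∧ ∀ j, j ≤ m → tCoeff F j = tCoeff F (m - j)

/-- Every coefficient `a_j(x)` of `F(x, t) = ∑_j a_j(x) t ^ j` is `e`-positive of degree `n`. -/
def IsEPositiveInT (n : ℕ) (F : MvPowerSeries ℕ+ (Polynomial ℚ)) : Prop :=
  ∀ j, IsEPositive n (tCoeff F j)

/-- `e`-unimodality of `F(x, t) = ∑_{j = 0}^{m} a_j(x) t ^ j` (palindromic, of degree `n` in `x`):
`a_{j + 1} - a_j` is `e`-positive whenever `j ≤ (m - 1) / 2`. -/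
def IsEUnimodal (n m : ℕ) (F : MvPowerSeries ℕ+ (Polynomial ℚ)) : Prop :=
  ∀ j : ℕ, (j : ℚ) ≤ ((m : ℚ) - 1) / 2 → IsEPositive n (tCoeff F (j + 1) - tCoeff F j)

/-- The `t`-integer `[k]_t = 1 + t + ⋯ + t ^ (k - 1)`. -/
noncomputable def tInt (k : ℕ) : Polynomial ℚ := ∑ i ∈ Finset.range k, Polynomial.X ^ i

/-- The weight `μ₁ · t[μ₁ - 1]_t · t[μ₂ - 1]_t ⋯ t[μ_l - 1]_t` of a composition
`μ = (μ₁, …, μ_l)` (of a positive integer). -/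
noncomputable def weight {n : ℕ} (μ : Composition n) : Polynomial ℚ :=
  (μ.blocks.headD 0 : Polynomial ℚ) * (μ.blocks.map fun k => Polynomial.X * tInt (k - 1)).prod

end InT

end ChromaticQSym

/-!
Restricted to finitely many variables, the chromatic quasisymmetric function of the directed
`n`-cycle is `tr Mⁿ`, where `M i j` is `t x_j`, `x_j` or `0` according as `i < j`, `i > j` or
`i = j`. A suitable rank-one perturbation makes `1 - z M` triangular, so its determinant can be
computed: the coefficient of `z ^ k` is `-t [k - 1]_t e_k` for `k ≥ 1`. Newton's identities
express `tr Mⁿ` through these coefficients, as a sum over compositions. Finally, each factor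
`t [k - 1]_t` is a palindromic unimodal polynomial with nonnegative coefficients, and this property
passes to products and to sums with a common center of symmetry.
-/

namespace ChromaticQSym

open Finset

section CharpolyRev

open Polynomial

variable {ι R : Type*} [Fintype ι] [DecidableEq ι] [CommRing R]

theorem derivative_det (B : Matrix ι ι R[X]) :
    derivative B.det = (B.adjugate * B.map derivative).trace := by
  have htrace : (B.adjugate * B.map derivative).trace
      = ∑ i, (B.updateCol i fun k => derivative (B k i)).det := by
    refine sum_congr rfl fun i _ => ?_
    rw [← Matrix.cramer_apply, Matrix.cramer_eq_adjugate_mulVec]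
    rfl
  simp only [htrace, Matrix.det_apply]
  rw [sum_comm, map_sum]
  refine sum_congr rfl fun σ _ => ?_
  rw [← smul_sum, Units.smul_def, Units.smul_def, map_zsmul, derivative_prod_finset]
  congr 1
  refine sum_congr rfl fun i _ => ?_
  rw [← mul_prod_erase univ _ (mem_univ i), Matrix.updateCol_self, mul_comm]
  congr 1
  exact prod_congr rfl fun j hj => by rw [Matrix.updateCol_ne (ne_of_mem_erase hj)]

theorem map_coeff_adjugate_one_sub_X_smul (M : Matrix ι ι R) (k : ℕ) :
    (1 - (X : R[X]) • M.map C).adjugate.map (coeff · k)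
      = ∑ i ∈ range (k + 1), M.charpolyRev.coeff i • M ^ (k - i) := by
  set B : Matrix ι ι R[X] := 1 - (X : R[X]) • M.map C with hB
  have hadj : B.adjugate = M.charpolyRev • 1 + (X : R[X]) • (M.map C * B.adjugate) := by
    rw [Matrix.charpolyRev, ← hB, ← Matrix.mul_adjugate]
    nth_rw 2 [hB]
    rw [Matrix.sub_mul, Matrix.one_mul, Matrix.smul_mul, sub_add_cancel]
  induction k with
  | zero =>
    rw [hadj]
    ext i j
    by_cases hij : i = j <;> simp [hij, coeff_zero_eq_eval_zero]
  | succ k ih =>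
    have hrec : B.adjugate.map (coeff · (k + 1))
        = M.charpolyRev.coeff (k + 1) • 1 + M * B.adjugate.map (coeff · k) := by
      conv_lhs => rw [hadj]
      ext i j
      simp [Matrix.one_apply, Matrix.mul_apply, apply_ite (coeff · (k + 1))]
    rw [hrec, ih, sum_range_succ _ (k + 1), mul_sum, Nat.sub_self, pow_zero, add_comm]
    congr 1
    refine sum_congr rfl fun i hi => ?_
    rw [Matrix.mul_smul, ← pow_succ', Nat.succ_sub (mem_range_succ_iff.mp hi)]

theorem newton_identity_charpolyRev (M : Matrix ι ι R) (m : ℕ) :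
    M.charpolyRev.coeff (m + 1) * (m + 1)
      = -∑ i ∈ range (m + 1), M.charpolyRev.coeff i * (M ^ (m + 1 - i)).trace := by
  set B : Matrix ι ι R[X] := 1 - (X : R[X]) • M.map C with hB
  have hderiv : B.map (derivative) = -M.map C := by
    ext1 i j
    simp [hB, Matrix.one_apply, apply_ite]
  have hcoeff : (B.adjugate * M.map C).trace.coeff m
      = (B.adjugate.map (coeff · m) * M).trace := by
    simp [Matrix.trace, Matrix.mul_apply, finsetSum_coeff]
  have hadj := map_coeff_adjugate_one_sub_X_smul M m
  rw [← hB] at hadj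
  calc M.charpolyRev.coeff (m + 1) * (m + 1)
      = (derivative B.det).coeff m := (coeff_derivative _ _).symm
    _ = -(B.adjugate.map (coeff · m) * M).trace := by
        rw [derivative_det, hderiv, Matrix.mul_neg, Matrix.trace_neg, coeff_neg, hcoeff]
    _ = -∑ i ∈ range (m + 1), M.charpolyRev.coeff i * (M ^ (m + 1 - i)).trace := by
        rw [hadj, sum_mul, Matrix.trace_sum]
        congr 1
        refine sum_congr rfl fun i hi => ?_
        rw [Matrix.smul_mul, ← pow_succ, Matrix.trace_smul, smul_eq_mul,
          Nat.succ_sub (mem_range_succ_iff.mp hi)]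

end CharpolyRev

section Composition

theorem sum_composition_succ {A : Type*} [AddCommMonoid A] (f : List ℕ → A) (m : ℕ) :
    ∑ μ : Composition (m + 1), f μ.blocks
      = ∑ k ∈ range (m + 1), ∑ ν : Composition (m - k), f ((k + 1) :: ν.blocks) := by
  rw [sum_sigma']
  symm
  refine sum_bij (fun x hx => ⟨(x.1 + 1) :: x.2.blocks, ?_, ?_⟩) (fun _ _ => mem_univ _) ?_ ?_
    fun _ _ => rfl
  · rintro i hi
    rcases List.mem_cons.mp hi with rfl | h
    · exact Nat.succ_pos _
    · exact x.2.blocks_pos h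
  · have := mem_range.mp (mem_sigma.mp hx).1
    rw [List.sum_cons, x.2.blocks_sum]
    omega
  · rintro ⟨k, ν⟩ _ ⟨k', ν'⟩ _ h
    obtain ⟨hk, hν⟩ := List.cons_eq_cons.mp (congrArg Composition.blocks h)
    obtain rfl : k = k' := Nat.succ_injective hk
    obtain rfl : ν = ν' := Composition.ext hν
    rfl
  · rintro ⟨_ | ⟨b, l⟩, hpos, hsum⟩ _
    · simp at hsum
    · have hb : 0 < b := hpos List.mem_cons_self
      rw [List.sum_cons] at hsum
      refine ⟨⟨b - 1, ⟨l, fun h => hpos (List.mem_cons_of_mem _ h), by omega⟩⟩, ?_, ?_⟩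
      · simp only [mem_sigma, mem_range, mem_univ, and_true]
        omega
      · ext1
        simp [Nat.sub_add_cancel hb]

variable {A : Type*} [CommSemiring A] {c p : ℕ → A}

theorem eq_sum_composition_getLastD_of_newton
    (hp : ∀ m, p (m + 1) = (m + 1 : ℕ) * c (m + 1) + ∑ k ∈ range m, c (k + 1) * p (m - k))
    (m : ℕ) :
    p (m + 1) = ∑ μ : Composition (m + 1), (μ.blocks.getLastD 0 : A) * (μ.blocks.map c).prod := by
  induction m using Nat.strong_induction_on with
  | _ m ih =>
    rw [sum_composition_succ (fun l => ((l.getLastD 0 : ℕ) : A) * (l.map c).prod),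
      sum_range_succ, hp, add_comm]
    congr 1
    · refine sum_congr rfl fun k hk => ?_
      obtain ⟨r, hr⟩ := Nat.exists_eq_add_of_lt (mem_range.mp hk)
      rw [show m - k = r + 1 by omega, ih r (by omega), mul_sum]
      refine sum_congr rfl fun ν _ => ?_
      obtain ⟨b, l, hbl⟩ := List.exists_cons_of_ne_nil
        (mt ν.blocks_eq_nil.mp r.succ_ne_zero)
      simp only [hbl, List.map_cons, List.prod_cons, List.getLastD_cons]
      ring
    · rw [Nat.sub_self, Fintype.sum_eq_single (Composition.ones 0) fun ν hν =>
        (hν (Composition.eq_ones_iff_length.mpr (Nat.le_zero.mp ν.length_le))).elim]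
      simp

theorem sum_composition_getLastD_eq_headD (c : ℕ → A) (n : ℕ) :
    ∑ μ : Composition n, (μ.blocks.getLastD 0 : A) * (μ.blocks.map c).prod
      = ∑ μ : Composition n, (μ.blocks.headD 0 : A) * (μ.blocks.map c).prod := by
  refine Fintype.sum_bijective _ Composition.reverse_bijective _ _ fun μ => ?_
  rw [Composition.reverse_blocks, List.map_reverse, List.prod_reverse,
    List.headD_eq_head?_getD, List.head?_reverse, List.getLastD_eq_getLast?]

end Composition

section Trace

variable {ι R : Type*} [Fintype ι] [DecidableEq ι]

theorem trace_pow_eq_sum_composition [CommRing R] (M : Matrix ι ι R) (n : ℕ) [NeZero n] :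
    (M ^ n).trace = ∑ μ : Composition n,
      (μ.blocks.headD 0 : R) * (μ.blocks.map fun k => -M.charpolyRev.coeff k).prod := by
  obtain ⟨m, rfl⟩ := Nat.exists_eq_succ_of_ne_zero (NeZero.ne n)
  rw [← sum_composition_getLastD_eq_headD,
    ← eq_sum_composition_getLastD_of_newton (p := fun n => (M ^ n).trace) fun m => ?_]
  have hzero : M.charpolyRev.coeff 0 = 1 := by
    rw [Polynomial.coeff_zero_eq_eval_zero, Matrix.eval_charpolyRev]
  have hnewton := newton_identity_charpolyRev M m
  rw [sum_range_succ', hzero, one_mul, Nat.sub_zero] at hnewton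
  simp only [Nat.add_sub_add_right] at hnewton
  simp only [neg_mul, sum_neg_distrib]
  push_cast
  linear_combination hnewton

theorem pow_succ_apply_eq_sum_prod [CommSemiring R] (M : Matrix ι ι R) (m : ℕ) (i j : ι) :
    (M ^ (m + 1)) i j = ∑ κ : Fin m → ι,
      ∏ l : Fin (m + 1),
        M (Fin.cons (α := fun _ => ι) i κ l) (Fin.snoc (α := fun _ => ι) κ j l) := by
  induction m generalizing i with
  | zero => simp [Fin.snoc]
  | succ m ih =>
    rw [pow_succ', Matrix.mul_apply, ← (Fin.consEquiv fun _ => ι).sum_comp, Fintype.sum_prod_type]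
    refine sum_congr rfl fun k _ => ?_
    rw [ih, mul_sum]
    refine sum_congr rfl fun κ _ => ?_
    simp only [Fin.consEquiv, Equiv.coe_fn_mk, Fin.prod_univ_succ (n := m + 1),
      ← Fin.cons_snoc_eq_snoc_cons, Fin.cons_zero, Fin.cons_succ]

theorem trace_pow_eq_sum_prod [CommSemiring R] (M : Matrix ι ι R) (n : ℕ) [NeZero n] :
    (M ^ n).trace = ∑ κ : Fin n → ι, ∏ l, M (κ l) (κ (l + 1)) := by
  obtain ⟨m, rfl⟩ := Nat.exists_eq_succ_of_ne_zero (NeZero.ne n)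
  rw [← (Fin.consEquiv fun _ => ι).sum_comp, Fintype.sum_prod_type]
  refine sum_congr rfl fun i _ => ?_
  rw [Matrix.diag_apply, pow_succ_apply_eq_sum_prod]
  simp only [Fin.snoc_eq_cons_rotate, finRotate_apply, Fin.consEquiv_apply]

end Trace

section TransferMatrix

theorem exists_det_add_smul_vecMulVec {ι R : Type*} [Fintype ι] [DecidableEq ι] [CommRing R]
    (B : Matrix ι ι R) (u v : ι → R) :
    ∃ w, ∀ s : R, (B + s • Matrix.vecMulVec u v).det = B.det + s * w := by
  -- The left side is a bordered determinant, and `s` occurs only in its last column.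
  let N : Matrix (ι ⊕ Unit) (ι ⊕ Unit) R :=
    Matrix.fromBlocks B 0 (Matrix.replicateRow Unit v) 1
  let c : ι ⊕ Unit → R := Sum.elim 0 1
  let d : ι ⊕ Unit → R := Sum.elim (-u) 0
  refine ⟨(N.updateCol (Sum.inr ()) d).det, fun s => ?_⟩
  have hborder : (N.updateCol (Sum.inr ()) (c + s • d)).det
      = (B + s • Matrix.vecMulVec u v).det := by
    have hblocks : N.updateCol (Sum.inr ()) (c + s • d)
        = Matrix.fromBlocks B (-(s • Matrix.replicateCol Unit u))
            (Matrix.replicateRow Unit v) 1 := by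
      ext (i | i) (j | j) <;> simp [N, c, d]
    rw [hblocks, Matrix.det_fromBlocks_one₂₂, Matrix.neg_mul, sub_neg_eq_add, Matrix.smul_mul,
      ← Matrix.vecMulVec_eq]
  have hself : N.updateCol (Sum.inr ()) c = N := by
    ext (i | i) (j | j) <;> simp [N, c]
  rw [← hborder, Matrix.det_updateCol_add, Matrix.det_updateCol_smul, hself,
    Matrix.det_fromBlocks_zero₁₂, Matrix.det_one, mul_one]

section GeneratingFunction

open Polynomial

variable {ι R : Type*} [CommSemiring R]

theorem coeff_prod_one_add_X_mul_C [Fintype ι] (x : ι → R) (k : ℕ) :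
    (∏ i, (1 + X * C (x i))).coeff k = (univ.val.map x).esymm k := by
  rw [prod_one_add, finsetSum_coeff, esymm_map_val, powersetCard_eq_filter, sum_filter]
  refine sum_congr rfl fun T _ => ?_
  rw [prod_mul_distrib, prod_const, ← map_prod, mul_comm, coeff_C_mul, coeff_X_pow]
  simp [eq_comm]

theorem esymm_map_const_mul (t : R) (s : Multiset ι) (x : ι → R) (k : ℕ) :
    (s.map fun i => t * x i).esymm k = t ^ k * (s.map x).esymm k := by
  rw [← smul_eq_mul (t ^ k), Multiset.pow_smul_esymm, Multiset.map_map]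
  rfl

end GeneratingFunction

variable {ι R : Type*} [LinearOrder ι]

/-- The transfer matrix of ascent-weighted proper colorings with color set `ι`: a step from color
`i` to color `j` has weight `t * x j` if it is an ascent, `x j` if it is a descent, and `0` if
`i = j`. -/
def transferMatrix [Semiring R] (t : R) (x : ι → R) : Matrix ι ι R :=
  Matrix.of fun i j => (if i < j then t else if j < i then 1 else 0) * x j

theorem prod_transferMatrix_cycle [CommSemiring R] {n : ℕ} [NeZero n] (t : R) (x : ι → R)
    (κ : Fin n → ι) :
    ∏ l, transferMatrix t x (κ l) (κ (l + 1))
      = if ∀ l, κ l ≠ κ (l + 1) then t ^ #{l | κ l < κ (l + 1)} * ∏ l, x (κ l) else 0 := by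
  split_ifs with hκ
  · have hstep (l) : (if κ l < κ (l + 1) then t else if κ (l + 1) < κ l then 1 else 0)
        = if κ l < κ (l + 1) then t else 1 := by
      rcases (hκ l).lt_or_gt with h | h
      · simp only [h, if_true]
      · simp only [h, h.not_gt, if_true, if_false]
    simp only [transferMatrix, Matrix.of_apply, prod_mul_distrib, hstep]
    rw [prod_ite, prod_const, prod_const_one, mul_one]
    congr 1
    exact Fintype.prod_equiv (Equiv.addRight 1) _ _ fun _ => rfl
  · push Not at hκ
    obtain ⟨l, hl⟩ := hκ
    refine prod_eq_zero (mem_univ l) ?_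
    simp [transferMatrix, ← hl]

variable [Fintype ι] [CommRing R]

open Polynomial in
/-- Adding `s • (1, …, 1)ᵀ (X x₁, X x₂, …)` to `1 - X M` makes it upper triangular for `s = 1` and
lower triangular for `s = t`. -/
theorem sub_one_mul_charpolyRev_transferMatrix (t : R) (x : ι → R) :
    (C t - 1) * (transferMatrix t x).charpolyRev
      = C t * ∏ i, (1 + X * C (x i)) - ∏ i, (1 + X * C (t * x i)) := by
  set B : Matrix ι ι R[X] := 1 - (X : R[X]) • (transferMatrix t x).map C with hB
  set v : ι → R[X] := fun j => X * C (x j) with hv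
  obtain ⟨w, hw⟩ := exists_det_add_smul_vecMulVec B 1 v
  have hentry (s : R[X]) (i j : ι) :
      (B + s • Matrix.vecMulVec 1 v : Matrix ι ι R[X]) i j
        = (if i = j then 1 else 0)
          + (s - C (if i < j then t else if j < i then 1 else 0)) * v j := by
    simp only [hB, hv, transferMatrix, Matrix.add_apply, Matrix.sub_apply, Matrix.smul_apply,
      Matrix.one_apply, Matrix.map_apply, Matrix.of_apply, Matrix.vecMulVec_apply, Pi.one_apply,
      smul_eq_mul, map_mul]
    ring
  have hupper : B.det + 1 * w = ∏ i, (1 + X * C (x i)) := by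
    rw [← hw, Matrix.det_of_isUpperTriangular]
    · exact prod_congr rfl fun i _ => by rw [hentry]; simp [hv]
    · intro i j (hij : j < i)
      rw [hentry]
      simp [hij.ne', hij.not_gt, hij]
  have hlower : B.det + C t * w = ∏ i, (1 + X * C (t * x i)) := by
    rw [← hw, Matrix.det_of_isLowerTriangular]
    · refine prod_congr rfl fun i _ => ?_
      rw [hentry, if_pos rfl, if_neg (lt_irrefl i), if_neg (lt_irrefl i), map_zero, map_mul]
      ring
    · intro i j (hij : i < j)
      rw [hentry]
      simp [hij.ne, hij]
  change (C t - 1) * B.det = _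
  linear_combination C t * hupper - hlower

theorem neg_coeff_succ_charpolyRev_transferMatrix {t : R} (ht : IsLeftRegular (t - 1)) (x : ι → R)
    (k : ℕ) :
    -(transferMatrix t x).charpolyRev.coeff (k + 1)
      = t * (∑ i ∈ range k, t ^ i) * (univ.val.map x).esymm (k + 1) := by
  have hcoeff := congrArg (Polynomial.coeff · (k + 1)) (sub_one_mul_charpolyRev_transferMatrix t x)
  simp only [sub_mul, one_mul, Polynomial.coeff_sub, Polynomial.coeff_C_mul,
    coeff_prod_one_add_X_mul_C, esymm_map_const_mul] at hcoeff
  apply ht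
  linear_combination -hcoeff - t * (univ.val.map x).esymm (k + 1) * mul_geom_sum t k

end TransferMatrix

section FinitelyManyVariables

variable {R σ τ : Type*} [CommSemiring R]

theorem mvPowerSeries_ext_of_killCompl {f g : MvPowerSeries τ R}
    (h : ∀ S : Finset τ, MvPowerSeries.killCompl (.subtype (· ∈ S)) f
      = MvPowerSeries.killCompl (.subtype (· ∈ S)) g) :
    f = g := by
  ext d
  obtain ⟨d', hd'⟩ : d ∈ Set.range (Finsupp.embDomain (.subtype (· ∈ d.support))) :=
    (Finsupp.mem_range_embDomain_iff _ _).mpr fun i hi => ⟨⟨i, hi⟩, rfl⟩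
  rw [← hd', ← MvPowerSeries.coeff_killCompl, ← MvPowerSeries.coeff_killCompl, h]

theorem prod_X_eq_monomial {V : Type*} (s : Finset V) (κ : V → σ) :
    ∏ v ∈ s, (MvPowerSeries.X (κ v) : MvPowerSeries σ R)
      = MvPowerSeries.monomial (∑ v ∈ s, Finsupp.single (κ v) 1) 1 := by
  simp only [MvPowerSeries.X, MvPowerSeries.prod_monomial, prod_const_one]

theorem eq_sum_single_one_iff {d : σ →₀ ℕ} {T : Finset σ} :
    d = ∑ i ∈ T, Finsupp.single i 1 ↔ T = d.support ∧ ∀ i, d i ≤ 1 := by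
  classical
  have happly (i : σ) : (∑ j ∈ T, Finsupp.single j 1 : σ →₀ ℕ) i = if i ∈ T then 1 else 0 := by
    simp [Finsupp.single_apply]
  simp only [DFunLike.ext_iff, happly, Finset.ext_iff, Finsupp.mem_support_iff, ← forall_and]
  refine forall_congr' fun i => ?_
  split_ifs with hi <;> simp only [hi, true_iff, false_iff] <;> omega

variable [Fintype σ]

theorem coeff_esymm_map_X (k : ℕ) (d : σ →₀ ℕ) [Decidable (d.degree = k ∧ ∀ i, d i ≤ 1)] :
    MvPowerSeries.coeff d ((univ.val.map (MvPowerSeries.X (R := R))).esymm k)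
      = if d.degree = k ∧ ∀ i, d i ≤ 1 then 1 else 0 := by
  classical
  have hmonomial (T : Finset σ) : ∏ i ∈ T, (MvPowerSeries.X i : MvPowerSeries σ R)
      = MvPowerSeries.monomial (∑ i ∈ T, Finsupp.single i 1) 1 := prod_X_eq_monomial T id
  rw [esymm_map_val, map_sum]
  simp only [hmonomial, MvPowerSeries.coeff_monomial, eq_sum_single_one_iff,
    ite_and, sum_ite_eq', mem_powersetCard_univ]
  rw [← ite_and]
  refine if_congr (and_congr_left fun hd => ?_) rfl rfl
  have hdegree : d.degree = #d.support := by
    conv_lhs => rw [eq_sum_single_one_iff.mpr ⟨rfl, hd⟩]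
    simp
  rw [hdegree]

theorem killCompl_esymm (e : σ ↪ ℕ+) (k : ℕ) :
    MvPowerSeries.killCompl e (esymm R k) = (univ.val.map MvPowerSeries.X).esymm k := by
  classical
  ext d
  rw [MvPowerSeries.coeff_killCompl, coeff_esymm_map_X]
  refine if_congr (and_congr ?_ ⟨fun h i => ?_, fun h i => ?_⟩) rfl rfl
  · rw [Finsupp.degree_apply, Finsupp.degree_apply, Finsupp.support_embDomain, sum_map]
    simp only [Finsupp.embDomain_apply_self]
  · simpa using h (e i)
  · by_cases hi : i ∈ Set.range e
    · obtain ⟨j, rfl⟩ := hi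
      simpa using h j
    · simp [Finsupp.embDomain_of_notMem_range _ _ _ hi]

end FinitelyManyVariables

section Digraph

variable {V σ : Type*} [Fintype V]

theorem content_comp_embedding (e : σ ↪ ℕ+) (κ : V → σ) :
    content (e ∘ κ) = Finsupp.embDomain e (∑ v, Finsupp.single (κ v) 1) := by
  rw [← Finsupp.embDomain.addMonoidHom_apply, map_sum]
  simp [content]

theorem exists_comp_eq_of_content_eq_embDomain {e : σ ↪ ℕ+} {κ : V → ℕ+} {d : σ →₀ ℕ}
    (h : content κ = Finsupp.embDomain e d) : ∃ κ' : V → σ, e ∘ κ' = κ := by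
  have hrange (v : V) : κ v ∈ Set.range e := by
    by_contra hv
    have hzero : content κ (κ v) = 0 := by rw [h, Finsupp.embDomain_of_notMem_range _ _ _ hv]
    rw [content, Finsupp.finsetSum_apply] at hzero
    simpa using sum_eq_zero_iff.mp hzero v (mem_univ v)
  choose κ' hκ' using hrange
  exact ⟨κ', funext hκ'⟩

theorem killCompl_chromaticQSym [Fintype σ] [DecidableEq V] (G : Digraph V) (e : σ ↪ ℕ+)
    [DecidablePred fun κ : V → σ => IsProper G (e ∘ κ)] :
    MvPowerSeries.killCompl e (chromaticQSym G)
      = ∑ κ : V → σ with IsProper G (e ∘ κ),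
          MvPowerSeries.C (Polynomial.X ^ asc G (e ∘ κ)) * ∏ v, MvPowerSeries.X (κ v) := by
  classical
  ext1 d
  simp only [MvPowerSeries.coeff_killCompl, map_sum, prod_X_eq_monomial, MvPowerSeries.coeff_C_mul,
    MvPowerSeries.coeff_monomial, mul_ite, mul_one, mul_zero]
  rw [← sum_filter, filter_filter]
  symm
  refine sum_bij (fun κ _ => e ∘ κ) (fun κ hκ => ?_)
    (fun κ _ κ' _ h => e.injective.comp_left h) (fun κ hκ => ?_) fun _ _ => rfl
  · obtain ⟨hproper, hd⟩ := (mem_filter_univ _).mp hκ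
    exact (Set.Finite.mem_toFinset _).mpr ⟨hproper, by rw [content_comp_embedding, ← hd]⟩
  · obtain ⟨hproper, hd⟩ := (Set.Finite.mem_toFinset _).mp hκ
    obtain ⟨κ', rfl⟩ := exists_comp_eq_of_content_eq_embDomain hd
    rw [content_comp_embedding] at hd
    exact ⟨κ', (mem_filter_univ _).mpr ⟨hproper, (Finsupp.embDomain_injective e hd).symm⟩, rfl⟩

end Digraph

section Cycle

variable {n : ℕ} [NeZero n]

theorem directedCycle_adj (i j : Fin n) : (directedCycle n).Adj i j ↔ j = i + 1 := by
  obtain ⟨m, rfl⟩ := Nat.exists_eq_succ_of_ne_zero (NeZero.ne n)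
  rw [Fin.ext_iff, Fin.val_add_one]
  simp only [directedCycle]
  have := i.isLt
  have := j.isLt
  split_ifs with h
  · rw [h, Fin.val_last]
    omega
  · rw [Fin.ext_iff, Fin.val_last] at h
    omega

theorem ncard_adj_directedCycle (Q : Fin n → Fin n → Prop) [DecidablePred fun l => Q l (l + 1)] :
    Set.ncard {p : Fin n × Fin n | (directedCycle n).Adj p.1 p.2 ∧ Q p.1 p.2}
      = #{l | Q l (l + 1)} := by
  have himage : {p : Fin n × Fin n | (directedCycle n).Adj p.1 p.2 ∧ Q p.1 p.2}
      = (fun l => (l, l + 1)) '' ({l | Q l (l + 1)} : Finset (Fin n)) := by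
    ext ⟨i, j⟩
    simp only [directedCycle_adj, Set.mem_ofPred_eq, Set.mem_image, mem_coe, mem_filter_univ,
      Prod.mk.injEq]
    constructor
    · rintro ⟨rfl, h⟩
      exact ⟨i, h, rfl, rfl⟩
    · rintro ⟨_, h, rfl, rfl⟩
      exact ⟨rfl, h⟩
  rw [himage, Set.ncard_image_of_injective _ fun a b hab => congrArg Prod.fst hab,
    Set.ncard_coe_finset]

variable (n) in
theorem numEdges_directedCycle : numEdges (directedCycle n) = n := by
  simpa [numEdges] using ncard_adj_directedCycle (n := n) fun _ _ => True

theorem asc_directedCycle (κ : Fin n → ℕ+) :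
    asc (directedCycle n) κ = #{l | κ l < κ (l + 1)} :=
  ncard_adj_directedCycle fun i j => κ i < κ j

theorem isProper_directedCycle (κ : Fin n → ℕ+) :
    IsProper (directedCycle n) κ ↔ ∀ l, κ l ≠ κ (l + 1) := by
  simp [IsProper, directedCycle_adj]

theorem killCompl_chromaticQSym_directedCycle {σ : Type*} [Fintype σ] [LinearOrder σ]
    (e : σ ↪o ℕ+) :
    MvPowerSeries.killCompl e.toEmbedding (chromaticQSym (directedCycle n))
      = (transferMatrix (MvPowerSeries.C Polynomial.X) MvPowerSeries.X ^ n).trace := by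
  classical
  rw [killCompl_chromaticQSym, trace_pow_eq_sum_prod, sum_filter]
  refine sum_congr rfl fun κ _ => ?_
  rw [prod_transferMatrix_cycle]
  refine if_congr ?_ ?_ rfl
  · simp [isProper_directedCycle]
  · simp [asc_directedCycle]

theorem isLeftRegular_C_X_sub_one {σ : Type*} :
    IsLeftRegular (MvPowerSeries.C Polynomial.X - 1 : MvPowerSeries σ (Polynomial ℚ)) := by
  refine (IsRegular.of_ne_zero ?_).left
  rw [← map_one MvPowerSeries.C, ← map_sub, ← Polynomial.C_1]
  exact (map_ne_zero_iff _ MvPowerSeries.C_injective).mpr (Polynomial.X_sub_C_ne_zero 1)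

theorem killCompl_prod_esymm {σ : Type*} [Fintype σ] [LinearOrder σ] (e : σ ↪ ℕ+) (l : List ℕ)
    (hl : ∀ k ∈ l, 0 < k) :
    MvPowerSeries.killCompl e ((l.map fun k => Polynomial.X * tInt (k - 1)).prod •
        (l.map (esymm (Polynomial ℚ))).prod)
      = (l.map fun k => -(transferMatrix (MvPowerSeries.C Polynomial.X)
        (MvPowerSeries.X (R := Polynomial ℚ) (σ := σ))).charpolyRev.coeff k).prod := by
  rw [MvPowerSeries.smul_eq_C_mul, map_list_prod, List.map_map, ← List.prod_map_mul,
    map_list_prod, List.map_map]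
  congr 1
  refine List.map_congr_left fun k hk => ?_
  obtain ⟨r, rfl⟩ := Nat.exists_eq_add_of_lt (hl k hk)
  rw [zero_add, neg_coeff_succ_charpolyRev_transferMatrix isLeftRegular_C_X_sub_one,
    ← killCompl_esymm e]
  simp [tInt]

variable (n) in
theorem chromaticQSym_directedCycle_eq_sum_composition :
    chromaticQSym (directedCycle n) = ∑ μ : Composition n,
      weight μ • (μ.blocks.map (esymm (Polynomial ℚ))).prod := by
  refine mvPowerSeries_ext_of_killCompl fun S => ?_
  rw [map_sum]
  refine (killCompl_chromaticQSym_directedCycle (.subtype (· ∈ S))).trans ?_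
  rw [trace_pow_eq_sum_composition]
  refine sum_congr rfl fun μ _ => ?_
  rw [← killCompl_prod_esymm (.subtype (· ∈ S)) _ fun _ => μ.blocks_pos, weight, mul_smul,
    Nat.cast_smul_eq_nsmul, map_nsmul, nsmul_eq_mul]

theorem prod_esymm_blocks_eq_esymmPart {R : Type*} [CommSemiring R] {m : ℕ} (μ : Composition m) :
    (μ.blocks.map (esymm R)).prod = esymmPart R (.ofComposition m μ) := by
  simp [esymmPart, Nat.Partition.ofComposition]

variable (n) in
theorem chromaticQSym_directedCycle_eq_sum_partition :
    chromaticQSym (directedCycle n) = ∑ p : n.Partition,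
      (∑ μ : Composition n with Nat.Partition.ofComposition n μ = p, weight μ) •
        esymmPart (Polynomial ℚ) p := by
  rw [chromaticQSym_directedCycle_eq_sum_composition,
    ← sum_fiberwise univ (Nat.Partition.ofComposition n)]
  refine sum_congr rfl fun p _ => ?_
  rw [sum_smul]
  refine sum_congr rfl fun μ hμ => ?_
  obtain rfl := (mem_filter_univ _).mp hμ
  rw [prod_esymm_blocks_eq_esymmPart]

end Cycle

section SymmUnimodal

open Polynomial

section GeomSum

variable {R : Type*} [Semiring R]

theorem coeff_geom_sum (k j : ℕ) :
    (∑ i ∈ range k, (X : R[X]) ^ i).coeff j = if j < k then 1 else 0 := by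
  simp only [finsetSum_coeff, coeff_X_pow, sum_ite_eq, mem_range]

theorem natDegree_geom_sum_le (k : ℕ) : (∑ i ∈ range (k + 1), (X : R[X]) ^ i).natDegree ≤ k :=
  natDegree_le_iff_coeff_eq_zero.mpr fun j hj => by rw [coeff_geom_sum, if_neg (by omega)]

theorem reflect_geom_sum (k : ℕ) :
    (∑ i ∈ range (k + 1), (X : R[X]) ^ i).reflect k = ∑ i ∈ range (k + 1), X ^ i := by
  ext j
  rw [coeff_reflect, coeff_geom_sum, coeff_geom_sum]
  rcases le_or_gt j k with hj | hj
  · rw [revAt_le hj]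
    exact if_congr (by omega) rfl rfl
  · rw [revAt_eq_self_of_lt hj]

theorem coeff_succ_sub_coeff_mul_geom_sum {R : Type*} [Ring R] (p : R[X]) (k j : ℕ) :
    (p * ∑ i ∈ range (k + 1), X ^ i).coeff (j + 1)
        - (p * ∑ i ∈ range (k + 1), X ^ i).coeff j
      = p.coeff (j + 1) - if k ≤ j then p.coeff (j - k) else 0 := by
  have htelescope := congrArg (fun q => (p * q).coeff (j + 1)) (geom_sum_mul (X : R[X]) (k + 1))
  simp only [mul_sub, mul_one, ← mul_assoc, Polynomial.coeff_sub, coeff_mul_X, coeff_mul_X_pow',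
    Nat.add_le_add_iff_right, Nat.add_sub_add_right] at htelescope
  rw [← neg_sub, htelescope, neg_sub]

end GeomSum

/-- A polynomial `∑_{j = 0}^{m} a_j X ^ j` with nonnegative coefficients that is palindromic,
`a_j = a_{m - j}`, and whose coefficients increase up to the middle. -/
structure IsSymmUnimodal {R : Type*} [Semiring R] [PartialOrder R] (m : ℕ) (p : R[X]) : Prop where
  natDegree_le : p.natDegree ≤ m
  reflect_eq : p.reflect m = p
  coeff_nonneg : ∀ j, 0 ≤ p.coeff j
  coeff_le_succ : ∀ j, 2 * j + 1 ≤ m → p.coeff j ≤ p.coeff (j + 1)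

namespace IsSymmUnimodal

variable {R : Type*} {m : ℕ}

section Semiring

variable [Semiring R] [PartialOrder R] {p q : R[X]}

theorem coeff_tsub (h : IsSymmUnimodal m p) {j : ℕ} (hj : j ≤ m) :
    p.coeff (m - j) = p.coeff j := by
  conv_rhs => rw [← h.reflect_eq, coeff_reflect, revAt_le hj]

theorem coeff_le_coeff (h : IsSymmUnimodal m p) {a b : ℕ} (hba : b ≤ a) (hab : a + b ≤ m) :
    p.coeff b ≤ p.coeff a := by
  have hleft (a) (hba : b ≤ a) : 2 * a ≤ m + 1 → p.coeff b ≤ p.coeff a := by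
    induction a, hba using Nat.le_induction with
    | base => exact fun _ => le_rfl
    | succ a _ ih => exact fun ha => (ih (by omega)).trans (h.coeff_le_succ a (by omega))
  rcases le_total (2 * a) m with ha | ha
  · exact hleft a hba (by omega)
  · rw [← h.coeff_tsub (show a ≤ m by omega)]
    exact hleft _ (by omega) (by omega)

variable (R m) in
theorem zero : IsSymmUnimodal m (0 : R[X]) := ⟨by simp, by simp, by simp, by simp⟩

theorem mul_X (hp : IsSymmUnimodal m p) : IsSymmUnimodal (m + 2) (p * X) where
  natDegree_le := natDegree_mul_le_of_le hp.natDegree_le (natDegree_X_le.trans one_le_two)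
  reflect_eq := by
    have hX : (X : R[X]).reflect 2 = X := by
      simpa [revAt_le one_le_two] using reflect_monomial (R := R) 2 1
    rw [reflect_mul _ _ hp.natDegree_le (natDegree_X_le.trans one_le_two), hp.reflect_eq, hX]
  coeff_nonneg j := by
    cases j with
    | zero => simp
    | succ j => simpa only [coeff_mul_X] using hp.coeff_nonneg j
  coeff_le_succ j hj := by
    cases j with
    | zero => simpa using hp.coeff_nonneg 0
    | succ j => simpa only [coeff_mul_X] using hp.coeff_le_succ j (by omega)

variable [IsOrderedRing R]

variable (R) in
theorem one : IsSymmUnimodal 0 (1 : R[X]) where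
  natDegree_le := natDegree_one.le
  reflect_eq := by simp [reflect_one]
  coeff_nonneg j := by
    rw [coeff_one]
    split_ifs
    exacts [zero_le_one, le_rfl]
  coeff_le_succ j hj := by omega

theorem add (hp : IsSymmUnimodal m p) (hq : IsSymmUnimodal m q) : IsSymmUnimodal m (p + q) where
  natDegree_le := natDegree_add_le_of_degree_le hp.natDegree_le hq.natDegree_le
  reflect_eq := by rw [reflect_add, hp.reflect_eq, hq.reflect_eq]
  coeff_nonneg j := by
    rw [coeff_add]
    exact add_nonneg (hp.coeff_nonneg j) (hq.coeff_nonneg j)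
  coeff_le_succ j hj := by
    rw [coeff_add, coeff_add]
    exact add_le_add (hp.coeff_le_succ j hj) (hq.coeff_le_succ j hj)

theorem sum {ι : Type*} {s : Finset ι} {f : ι → R[X]} (h : ∀ i ∈ s, IsSymmUnimodal m (f i)) :
    IsSymmUnimodal m (∑ i ∈ s, f i) :=
  sum_induction f _ (fun _ _ => add) (zero R m) h

theorem natCast_mul (hp : IsSymmUnimodal m p) (a : ℕ) : IsSymmUnimodal m ((a : R[X]) * p) := by
  rw [← nsmul_eq_mul, ← card_range a, ← sum_const]
  exact sum fun _ _ => hp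

end Semiring

section Ring

variable [Ring R] [PartialOrder R] [IsOrderedRing R] {p : R[X]}

theorem mul_geom_sum (hp : IsSymmUnimodal m p) (k : ℕ) :
    IsSymmUnimodal (m + k) (p * ∑ i ∈ range (k + 1), X ^ i) where
  natDegree_le := natDegree_mul_le_of_le hp.natDegree_le (natDegree_geom_sum_le k)
  reflect_eq := by
    rw [reflect_mul _ _ hp.natDegree_le (natDegree_geom_sum_le k), hp.reflect_eq,
      reflect_geom_sum]
  coeff_nonneg j := by
    rw [coeff_mul]
    refine sum_nonneg fun x _ => mul_nonneg (hp.coeff_nonneg _) ?_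
    rw [coeff_geom_sum]
    split_ifs
    exacts [zero_le_one, le_rfl]
  coeff_le_succ j hj := by
    rw [← sub_nonneg, coeff_succ_sub_coeff_mul_geom_sum, sub_nonneg]
    split_ifs with hkj
    · exact hp.coeff_le_coeff (by omega) (by omega)
    · exact hp.coeff_nonneg _

end Ring

end IsSymmUnimodal

theorem isSymmUnimodal_prod_X_mul_tInt (l : List ℕ) (hl : ∀ k ∈ l, 0 < k) :
    IsSymmUnimodal l.sum (l.map fun k => X * tInt (k - 1)).prod := by
  induction l with
  | nil => exact .one ℚ
  | cons k l ih =>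
    have ih := ih fun k hk => hl k (List.mem_cons_of_mem _ hk)
    have hk : 0 < k := hl k List.mem_cons_self
    rw [List.sum_cons, List.map_cons, List.prod_cons, mul_comm, add_comm]
    obtain rfl | ⟨r, rfl⟩ : k = 1 ∨ ∃ r, k = r + 2 := by
      rcases k with _ | _ | r
      exacts [hk.false.elim, .inl rfl, .inr ⟨r, rfl⟩]
    · simpa [tInt] using IsSymmUnimodal.zero ℚ _
    · rw [mul_comm X, ← mul_assoc, ← add_assoc]
      exact (ih.mul_geom_sum r).mul_X

theorem isSymmUnimodal_weight {n : ℕ} (μ : Composition n) : IsSymmUnimodal n (weight μ) := by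
  have hprod := isSymmUnimodal_prod_X_mul_tInt μ.blocks fun _ => μ.blocks_pos
  rw [μ.blocks_sum] at hprod
  exact hprod.natCast_mul _

end SymmUnimodal

section EExpansion

open Polynomial

theorem map_esymm {R S : Type*} [CommSemiring R] [CommSemiring S] (f : R →+* S) (k : ℕ) :
    MvPowerSeries.map f (esymm R k) = esymm S k := by
  classical
  ext1 d
  rw [MvPowerSeries.coeff_map]
  exact (apply_ite f _ _ _).trans (if_congr Iff.rfl f.map_one f.map_zero)

variable {n : ℕ}

theorem map_esymmPart {R S : Type*} [CommSemiring R] [CommSemiring S] (f : R →+* S)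
    (p : n.Partition) : MvPowerSeries.map f (esymmPart R p) = esymmPart S p := by
  simp only [esymmPart, map_multiset_prod, Multiset.map_map, Function.comp_apply, map_esymm]

theorem tCoeff_sum_smul_esymmPart (w : n.Partition → ℚ[X]) (j : ℕ) :
    tCoeff (∑ p, w p • esymmPart ℚ[X] p) j = ∑ p, (w p).coeff j • esymmPart ℚ p := by
  ext1 d
  change (MvPowerSeries.coeff d (∑ p, w p • esymmPart ℚ[X] p)).coeff j = _
  simp only [map_sum, finsetSum_coeff, ← map_esymmPart C, MvPowerSeries.coeff_smul,
    MvPowerSeries.coeff_map, coeff_mul_C]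

variable {w : n.Partition → ℚ[X]} {m : ℕ}

theorem isPalindromic_sum_smul_esymmPart (hw : ∀ p, IsSymmUnimodal m (w p)) :
    IsPalindromic m (∑ p, w p • esymmPart ℚ[X] p) := by
  refine ⟨fun j hj => ?_, fun j hj => ?_⟩
  · rw [tCoeff_sum_smul_esymmPart]
    refine sum_eq_zero fun p _ => ?_
    rw [coeff_eq_zero_of_natDegree_lt ((hw p).natDegree_le.trans_lt hj), zero_smul]
  · simp only [tCoeff_sum_smul_esymmPart, (hw _).coeff_tsub hj]

theorem isEPositiveInT_sum_smul_esymmPart (hw : ∀ p, IsSymmUnimodal m (w p)) :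
    IsEPositiveInT n (∑ p, w p • esymmPart ℚ[X] p) := fun j =>
  ⟨_, fun p => (hw p).coeff_nonneg j, tCoeff_sum_smul_esymmPart w j⟩

theorem isEUnimodal_sum_smul_esymmPart (hw : ∀ p, IsSymmUnimodal m (w p)) :
    IsEUnimodal n m (∑ p, w p • esymmPart ℚ[X] p) := by
  intro j hj
  have hjm : 2 * j + 1 ≤ m := by
    have : (2 * j + 1 : ℚ) ≤ m := by linarith
    exact_mod_cast this
  refine ⟨_, fun p => sub_nonneg.mpr ((hw p).coeff_le_succ j hjm), ?_⟩
  simp only [tCoeff_sum_smul_esymmPart, sub_smul, sum_sub_distrib]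

end EExpansion

end ChromaticQSym

theorem corollary6p2 (n : ℕ) (hn : 2 ≤ n) :
    ChromaticQSym.chromaticQSym (ChromaticQSym.directedCycle n) =
        ∑ p : n.Partition,
          (∑ μ : Composition n with Nat.Partition.ofComposition n μ = p,
            ChromaticQSym.weight μ) •
            ChromaticQSym.esymmPart (Polynomial ℚ) p ∧
      ChromaticQSym.IsPalindromic (ChromaticQSym.numEdges (ChromaticQSym.directedCycle n))
        (ChromaticQSym.chromaticQSym (ChromaticQSym.directedCycle n)) ∧
      ChromaticQSym.IsEPositiveInT n
        (ChromaticQSym.chromaticQSym (ChromaticQSym.directedCycle n)) ∧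
      ChromaticQSym.IsEUnimodal n (ChromaticQSym.numEdges (ChromaticQSym.directedCycle n))
        (ChromaticQSym.chromaticQSym (ChromaticQSym.directedCycle n)) := by
  have : NeZero n := ⟨by omega⟩
  have hsymm (p : n.Partition) : ChromaticQSym.IsSymmUnimodal n
      (∑ μ : Composition n with Nat.Partition.ofComposition n μ = p, ChromaticQSym.weight μ) :=
    .sum fun μ _ => ChromaticQSym.isSymmUnimodal_weight μ
  rw [ChromaticQSym.numEdges_directedCycle,
    ChromaticQSym.chromaticQSym_directedCycle_eq_sum_partition]
  exact ⟨rfl, ChromaticQSym.isPalindromic_sum_smul_esymmPart hsymm,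
    ChromaticQSym.isEPositiveInT_sum_smul_esymmPart hsymm,
    ChromaticQSym.isEUnimodal_sum_smul_esymmPart hsymm⟩
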